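/- **Setting.** Fix a universal machine $U$, i.e. a partial recursive function taking a program $p\in\{0,1\}^*$ and a condition $y\in\mathbb N$ such that for every partial recursive $T$ there is a constant $c$ so that $T(p,y)=x$ implies $U(q,y)=x$ for some $q$ with $|q|\le|p|+c$. Let $C(x\mid y)$ be the least length of a program $p$ with $U(p,y)=x$. For a graph $G$ on the nodes $1,\dots,n$ let $E(G)\in\{0,1\}^{n(n-1)/2}$ be its adjacency code (the pairs $u<v$ in lexicographical order). For $\delta:\mathbb N\to\mathbb N$, $G$ is $\delta(n)$-random if $C(E(G)\mid n,\delta(n))\ge n(n-1)/2-\delta(n)$. A port assignment matches, at every node $u$ of degree $d$, the ports $1,\dots,d$ bijectively with the edges incident to $u$. A routing scheme on $G$ consists of a port assignment, a label $\ell(u)\in\{0,1\}^*$ and a stored string $F(u)\in\{0,1\}^*$ for every node $u$. Stored strings are interpreted by a fixed partial recursive function $R$ (the language in which routing functions are written): for a message with destination $v\ne u$, node $u$ uses the port with number $R(F(u),\ell(u),\deg u,n,\ell(v))$; in particular, nodes do not know the labels of their neighbours. The scheme is a shortest path routing scheme if, for all nodes $u,v$, the route from $u$ to $v$ obtained in this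 way is a path of length $\mathrm{dist}(u,v)$. The port assignment is either fixed in advance (IA) or may be chosen by the scheme (IB). The labels are either $\ell(u)=u$ in binary ($\alpha$), or $\ell(u)=\sigma(u)$ in binary for a permutation $\sigma$ of $\{1,\dots,n\}$ ($\beta$), or arbitrary distinct binary strings ($\gamma$). The total number of bits of the scheme is $\sum_u|F(u)|$ in models $\alpha,\beta$ and $\sum_u(|F(u)|+|\ell(u)|)$ in model $\gamma$. **Theorem.** Let $U$ and $R$ be as above and let $\delta:\mathbb N\to\mathbb N$ satisfy $\delta(n)=o(n)$. There is a function $g$ with $g(n)=o(n^2)$ such that for every $n$, every $\delta(n)$-random graph $G$ on $n$ nodes, and each of the models IA, IB combined with any of $\alpha,\beta,\gamma$ (in particular with free relabeling $\gamma$), every shortest path routing scheme on $G$ that the model allows has a total of at least $n^2/32-g(n)$ bits. -/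

import Mathlib

open Filter Asymptotics

/-! ### Kolmogorov complexity -/

/-- `U` is a universal (additively optimal) machine for conditional descriptions. A machine is a
partial recursive function which receives a program (a binary string) and a condition
(a natural number) and may output a binary string. -/
def IsUniversal (U : List Bool × ℕ →. List Bool) : Prop :=
  Partrec U ∧ ∀ T : List Bool × ℕ →. List Bool, Partrec T →
    ∃ c : ℕ, ∀ (p : List Bool) (y : ℕ) (x : List Bool), x ∈ T (p, y) →
      ∃ q : List Bool, q.length ≤ p.length + c ∧ x ∈ U (q, y)

/-- The Kolmogorov complexity `C(x | y)` relative to the machine `U`. -/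
noncomputable def kolmogorovComplexity (U : List Bool × ℕ →. List Bool) (x : List Bool) (y : ℕ) :
    ℕ :=
  sInf {k : ℕ | ∃ p : List Bool, p.length = k ∧ x ∈ U (p, y)}

/-- The machine that on program `1^i 0 p` and condition `y` simulates the `i`-th partial recursive
function on `(p, y)`. -/
def referenceMachine (w : List Bool × ℕ) : Part (List Bool) :=
  let i := w.1.findIdx (fun b => !b)
  let p := (List.tail)^[i + 1] w.1
  (Nat.Partrec.Code.eval (Denumerable.ofNat Nat.Partrec.Code i) (Encodable.encode (p, w.2))).bind
    (fun m => Part.ofOption (Encodable.decode (α := List Bool) m))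

/-- Universal machines exist. -/
theorem isUniversal_referenceMachine : IsUniversal referenceMachine := by
  have hi : Primrec (fun w : List Bool × ℕ => w.1.findIdx (fun b => !b)) :=
    Primrec.list_findIdx Primrec.fst (Primrec.not.comp Primrec.snd).to₂
  have hp : Primrec (fun w : List Bool × ℕ =>
      (List.tail)^[w.1.findIdx (fun b => !b) + 1] w.1) :=
    Primrec.nat_iterate (Primrec.succ.comp hi) Primrec.fst
      (Primrec.list_tail.comp Primrec.snd).to₂
  refine ⟨?_, ?_⟩
  · refine Partrec.bind (Nat.Partrec.Code.eval_part.comp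
      ((Computable.ofNat Nat.Partrec.Code).comp hi.to_comp)
      (Computable.encode.comp (hp.to_comp.pair Computable.snd))) ?_
    exact Computable.ofOption (Computable.decode.comp Computable.snd)
  · intro T hT
    obtain ⟨cd, hcd⟩ := Nat.Partrec.Code.exists_code.1 hT
    refine ⟨Encodable.encode cd + 1, fun p y x hx => ?_⟩
    refine ⟨List.replicate (Encodable.encode cd) true ++ false :: p, by simp; omega, ?_⟩
    have h1 : ∀ k : ℕ, (List.replicate k true ++ false :: p).findIdx (fun b => !b) = k := by
      intro k
      induction k with
      | zero => simp [List.findIdx_cons]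
      | succ k ih => simp [List.replicate_succ, List.findIdx_cons, ih]
    have h2 : ∀ k : ℕ, (List.tail)^[k + 1] (List.replicate k true ++ false :: p) = p := by
      intro k
      induction k with
      | zero => simp
      | succ k ih =>
        rw [Function.iterate_succ_apply]
        simpa [List.replicate_succ] using ih
    simp only [referenceMachine, h1, h2, Denumerable.ofNat_encode, hcd]
    simp only [Encodable.encodek, Part.coe_some, Part.bind_some, Part.mem_bind_iff,
      Part.mem_map_iff]
    exact ⟨Encodable.encode x, ⟨x, hx, rfl⟩, by simp⟩

/-! ### Random labelled graphs -/

open Classical in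
/-- The standard code `E(G)`: for the possible edges `uv`, `u < v`, in lexicographical order, one
bit telling whether the edge is present. It has length `n(n-1)/2`. -/
noncomputable def graphCode {n : ℕ} (G : SimpleGraph (Fin n)) : List Bool :=
  (List.finRange n).flatMap fun u =>
    ((List.finRange n).filter fun v => u < v).map fun v => decide (G.Adj u v)

/-- `G` is `δ(n)`-random: `C(E(G) | n, δ(n)) ≥ n(n-1)/2 - δ(n)`, where `n(n-1)/2` is the binary
logarithm of the number of labelled graphs on `n` nodes. -/
def IsRandomGraph (U : List Bool × ℕ →. List Bool) (δ : ℕ → ℕ) {n : ℕ}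
    (G : SimpleGraph (Fin n)) : Prop :=
  (n : ℝ) * ((n : ℝ) - 1) / 2 - (δ n : ℝ) ≤
    (kolmogorovComplexity U (graphCode G) (Nat.pair n (δ n)) : ℝ)

/-! ### Routing schemes -/

/-- The number of neighbours of `u`. -/
noncomputable def nodeDegree {n : ℕ} (G : SimpleGraph (Fin n)) (u : Fin n) : ℕ :=
  (G.neighborSet u).ncard

/-- A port assignment: at each node `u` of degree `d`, the ports `1, …, d` are matched bijectively
with the incident edges (that is, with the neighbours of `u`). -/
abbrev PortAssignment {n : ℕ} (G : SimpleGraph (Fin n)) : Type :=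
  (u : Fin n) → Set.Icc 1 (nodeDegree G u) ≃ G.neighborSet u

/-- What a node can use to route a message, when it does not know its neighbours:
the bits stored there for its routing function, its own label, its number of ports, the number `n`
of nodes of the network, and the label of the destination. -/
structure RouterInput where
  stored : List Bool
  ownLabel : List Bool
  ports : ℕ
  size : ℕ
  destination : List Bool

/-- A language for local routing functions: a partial function that, run on what a node can use,
returns the number of a port. -/
abbrev RouterLanguage : Type := RouterInput →. ℕ

/-- The language is effective: it is a partial recursive function of the five inputs. -/
def RouterLanguage.Effective (R : RouterLanguage) : Prop :=
  Partrec fun t : List Bool × List Bool × ℕ × ℕ × List Bool =>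
    R ⟨t.1, t.2.1, t.2.2.1, t.2.2.2.1, t.2.2.2.2⟩

/-- A routing scheme on `G`: the port assignment and the node labels in use, and for each node the
binary string that encodes its local routing function. -/
structure RoutingScheme {n : ℕ} (G : SimpleGraph (Fin n)) where
  port : PortAssignment G
  label : Fin n → List Bool
  stored : Fin n → List Bool

namespace RoutingScheme

variable {n : ℕ} {G : SimpleGraph (Fin n)}

/-- The local routing function of `u` sends messages with destination `v` over a port of `u`
that leads to the neighbour `w`. -/
def Forwards (R : RouterLanguage) (S : RoutingScheme G) (u v w : Fin n) : Prop :=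
  ∃ i : Set.Icc 1 (nodeDegree G u),
    (i : ℕ) ∈ R ⟨S.stored u, S.label u, nodeDegree G u, n, S.label v⟩ ∧ (S.port u i : Fin n) = w

/-- Every edge of the walk to `v` is the one chosen by the local routing function for
destination `v`. -/
def Follows (R : RouterLanguage) (S : RoutingScheme G) {v : Fin n} : {u : Fin n} → G.Walk u v → Prop
  | _, .nil => True
  | u, .cons (v := w) _ q => S.Forwards R u v w ∧ S.Follows R q

/-- Shortest path routing: between every pair of nodes, the route described by the scheme
is a shortest path. -/
def IsShortestPath (R : RouterLanguage) (S : RoutingScheme G) : Prop :=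
  ∀ u v : Fin n, ∃ q : G.Walk u v, S.Follows R q ∧ q.length = G.dist u v

end RoutingScheme

/-! ### The models -/

/-- Models in which the nodes do not know their neighbours: port assignment fixed (`IA`) or
free (`IB`). -/
inductive PortModel where
  | IA
  | IB

/-- When the network initially has port assignment `P₀`, the scheme may use `P`. -/
def PortModel.Allows {n : ℕ} {G : SimpleGraph (Fin n)} (P₀ P : PortAssignment G) :
    PortModel → Prop
  | .IA => P = P₀
  | .IB => True

/-- No relabeling (`α`), relabeling by a permutation (`β`), free relabeling (`γ`). -/
inductive LabelModel where
  | α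
  | β
  | γ

/-- The initial labels `1, …, n`, written in binary (least significant bit first). -/
def initialLabel {n : ℕ} (u : Fin n) : List Bool :=
  Nat.bits ((u : ℕ) + 1)

/-- The labelings that the scheme may use. -/
def LabelModel.Allows {n : ℕ} (l : Fin n → List Bool) : LabelModel → Prop
  | .α => l = initialLabel
  | .β => ∃ σ : Equiv.Perm (Fin n), l = fun u => initialLabel (σ u)
  | .γ => Function.Injective l

/-- The number of bits charged for a label: under free relabeling its length, otherwise nothing. -/
def LabelModel.labelCost (l : List Bool) : LabelModel → ℕ
  | .α => 0
  | .β => 0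
  | .γ => l.length

/-- The total number of bits needed to store the routing scheme. -/
def RoutingScheme.totalBits {n : ℕ} {G : SimpleGraph (Fin n)} (S : RoutingScheme G)
    (lm : LabelModel) : ℕ :=
  ∑ u : Fin n, ((S.stored u).length + lm.labelCost (S.label u))

/-! ### Describing the elements of small recursively enumerable sets -/

/-! A short routing scheme compresses the graph. Fix at every node its stored string, label and
degree. The language `R` then determines which port each node `u` uses for each destination, so the
nodes other than `u` split into classes, one for each port used. A message to a neighbour must go
straight to it, and every first hop is itself a neighbour, so each class contains exactly one
neighbour of `u`. Hence the neighbourhood of `u` is a transversal of this partition. How ports are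
matched with edges never has to be described, which is why the bound holds for fixed and for free
ports.

A partition of fewer than `n` points has at most `8 ^ (n / 5)` transversals, by `x ^ 5 ≤ 8 ^ x` for
each class size (`card_isTransversal_pow_le`). Describing all `n` rows this way would cost `3n²/5`
bits, more than `n²/2`, since every edge is counted twice. So only the rows of the first `n / 2`
nodes are described by transversals, for about `3n²/10` bits, and the graph on the other nodes is
written out, for `n²/8` bits (`card_isCompatible_le`). Node data with at most `n²/30` bits
contribute `n²/15 + o(n²)` (`card_dataFamilies_le`). The sum is `59n²/120 + o(n²)`, below `n²/2` by
a quadratic margin.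

The codes of the graphs arising from certified data can be enumerated given `n`, because a
certificate consists of the matrix, the data and a bound on computation steps. So each of them has
complexity at most the logarithm of the count, up to a constant (`exists_kolmogorovComplexity_le`),
which contradicts randomness. -/

/-- The number written in binary, least significant bit first. -/
def bitsValue (p : List Bool) : ℕ := p.foldr (fun b r => 2 * r + cond b 1 0) 0

theorem primrec_bitsValue : Primrec bitsValue :=
  Primrec.list_foldr Primrec.id (Primrec.const 0)
    (Primrec.nat_add.comp
      (Primrec.nat_mul.comp (Primrec.const 2) (Primrec.snd.comp Primrec.snd))
      (Primrec.cond (Primrec.fst.comp Primrec.snd) (Primrec.const 1) (Primrec.const 0))).to₂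

theorem exists_bitsValue_eq (m i : ℕ) (h : i < 2 ^ m) :
    ∃ p : List Bool, p.length = m ∧ bitsValue p = i := by
  induction m generalizing i with
  | zero => exact ⟨[], rfl, by simp [bitsValue]; omega⟩
  | succ m ih =>
    obtain ⟨p, hp, hv⟩ := ih (i / 2) (by rw [pow_succ] at h; omega)
    refine ⟨decide (i % 2 = 1) :: p, by simp [hp], ?_⟩
    change 2 * bitsValue p + cond (decide (i % 2 = 1)) 1 0 = i
    rw [hv]
    rcases Nat.mod_two_eq_zero_or_one i with h0 | h0 <;> simp [h0] <;> omega

theorem primrecRel_forall_lt {γ : Type*} [Primcodable γ] {Q : ℕ → γ → Prop}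
    (hQ : PrimrecRel Q) : PrimrecRel fun n z => ∀ i < n, Q i z :=
  (hQ.forall_mem_list.comp (Primrec.list_range.comp Primrec.fst) Primrec.snd).of_eq (by simp)

theorem primrecRel_exists_lt {γ : Type*} [Primcodable γ] {Q : ℕ → γ → Prop}
    (hQ : PrimrecRel Q) : PrimrecRel fun n z => ∃ i < n, Q i z :=
  (hQ.exists_mem_list.comp (Primrec.list_range.comp Primrec.fst) Primrec.snd).of_eq (by simp)

/-- The `j`-th value of `o` is defined and did not occur before. -/
def IsNewValue {β : Type*} (o : ℕ → Option β) (j : ℕ) : Prop :=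
  (o j).isSome ∧ ∀ i < j, o i ≠ o j

instance {β : Type*} [DecidableEq β] (o : ℕ → Option β) : DecidablePred (IsNewValue o) :=
  fun j => inferInstanceAs (Decidable ((o j).isSome ∧ ∀ i < j, o i ≠ o j))

section

variable {β : Type*} [Primcodable β] {o : ℕ → ℕ → Option β}

theorem primrecRel_isNewValue (ho : Primrec₂ o) : PrimrecRel fun y j => IsNewValue (o y) j := by
  have h1 : PrimrecPred fun q : ℕ × ℕ => ((o q.1 q.2).isSome : Prop) :=
    (Primrec.eq.comp (Primrec.option_isSome.comp ho) (Primrec.const true))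
  have h2 : PrimrecRel fun (i : ℕ) (q : ℕ × ℕ) => o q.1 i ≠ o q.1 q.2 :=
    (Primrec.eq.comp (ho.comp (Primrec.fst.comp Primrec.snd) Primrec.fst)
      (ho.comp (Primrec.fst.comp Primrec.snd) (Primrec.snd.comp Primrec.snd))).not
  have h3 : PrimrecPred fun q : ℕ × ℕ => ∀ i < q.2, o q.1 i ≠ o q.1 q.2 :=
    PrimrecRel.comp (R := fun n q => ∀ i < n, o q.1 i ≠ o q.1 q.2) (primrecRel_forall_lt h2) Primrec.snd
      (Primrec.id (α := ℕ × ℕ))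
  exact h1.and h3

theorem primrec_count_isNewValue [DecidableEq β] (ho : Primrec₂ o) :
    Primrec₂ fun y j => Nat.count (IsNewValue (o y)) j := by
  have h : Primrec₂ fun (y : ℕ) (q : ℕ × ℕ) => q.2 + if IsNewValue (o y) q.1 then 1 else 0 :=
    Primrec.nat_add.comp (Primrec.snd.comp Primrec.snd)
      (Primrec.ite ((primrecRel_isNewValue ho).comp Primrec.fst (Primrec.fst.comp Primrec.snd))
        (Primrec.const 1) (Primrec.const 0))
  refine (Primrec.nat_rec (Primrec.const 0) h).of_eq fun y j => ?_
  induction j with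
  | zero => simp
  | succ j ih => exact (Nat.count_succ (IsNewValue (o y)) j).symm ▸ ih ▸ rfl

end

/-- If a finite set is enumerated by `o` then each of its elements occurs for the first time after
fewer new values than the set has elements. -/
theorem exists_isNewValue_count_lt {β : Type*} [DecidableEq β] {o : ℕ → Option β} {X : Set β}
    (hX : X.Finite) (hoX : ∀ j x, o j = some x → x ∈ X) {x : β} (hx : ∃ j, o j = some x) :
    ∃ j, o j = some x ∧ IsNewValue o j ∧ Nat.count (IsNewValue o) j < X.ncard := by
  classical
  refine ⟨Nat.find hx, Nat.find_spec hx, ?_⟩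
  have hj := Nat.find_spec hx
  have hmin := fun i => Nat.find_min (H := hx) (m := i)
  generalize Nat.find hx = j at hj hmin
  have hnew : IsNewValue o j := ⟨by simp [hj], fun i hi => by rw [hj]; exact hmin i hi⟩
  refine ⟨hnew, ?_⟩
  have h1 : Nat.count (IsNewValue o) (j + 1) ≤ X.ncard := by
    rw [Nat.count_eq_card_filter_range, ← Set.ncard_image_of_injective X (Option.some_injective β),
      Set.ncard_eq_toFinset_card _ (hX.image _)]
    refine Finset.card_le_card_of_injOn o ?_ ?_
    · intro i hi
      simp only [Finset.coe_filter, Set.mem_ofPred_eq] at hi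
      obtain ⟨z, hz⟩ := Option.isSome_iff_exists.1 hi.2.1
      simp [hz, hoX i z hz]
    · intro i hi k hk hik
      simp only [Finset.coe_filter, Set.mem_ofPred_eq] at hi hk
      by_contra hne
      rcases lt_or_gt_of_ne hne with h | h
      · exact hk.2.2 i h hik
      · exact hi.2.2 k h hik.symm
  rw [Nat.count_succ, if_pos hnew] at h1
  omega

/-- The elements of a uniformly enumerable family of finite sets of strings have conditional
complexity at most the logarithm of the size of the set, up to a constant. -/
theorem exists_kolmogorovComplexity_le {U : List Bool × ℕ →. List Bool} (hU : IsUniversal U)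
    {α : Type*} [Primcodable α] {P : ℕ → α → Prop} (hP : PrimrecRel P) {f : ℕ → α → List Bool}
    (hf : Primrec₂ f) :
    ∃ c : ℕ, ∀ (y m : ℕ) (X : Set (List Bool)), X.Finite → X.ncard ≤ 2 ^ m →
      (∀ a, P y a → f y a ∈ X) → ∀ a, P y a → kolmogorovComplexity U (f y a) y ≤ m + c := by
  classical
  -- Stage `j` decodes `j` as a candidate witness and outputs its string if the test `P` succeeds.
  -- The same string may be output many times, so only first occurrences are counted below.
  let o : ℕ → ℕ → Option (List Bool) := fun y j =>
    (Encodable.decode (α := α) j).bind fun a => if P y a then some (f y a) else none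
  have ho : Primrec₂ o := by
    refine Primrec.option_bind (Primrec.decode.comp Primrec.snd) ?_
    refine Primrec.ite (hP.comp (Primrec.fst.comp Primrec.fst) Primrec.snd) ?_ (Primrec.const none)
    exact Primrec.option_some.comp (hf.comp (Primrec.fst.comp Primrec.fst) Primrec.snd)
  -- The program is the rank, in binary, of the wanted string among the distinct strings enumerated.
  let t : List Bool × ℕ → ℕ → Bool := fun w j =>
    decide (IsNewValue (o w.2) j ∧ Nat.count (IsNewValue (o w.2)) j = bitsValue w.1)
  have ht : Primrec₂ t := by
    refine PrimrecPred.decide (PrimrecPred.and ?_ ?_)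
    · exact (primrecRel_isNewValue ho).comp (Primrec.snd.comp Primrec.fst) Primrec.snd
    · exact Primrec.eq.comp
        ((primrec_count_isNewValue ho).comp (Primrec.snd.comp Primrec.fst) Primrec.snd)
        (primrec_bitsValue.comp (Primrec.fst.comp Primrec.fst))
  let T : List Bool × ℕ →. List Bool := fun w =>
    (Nat.rfind fun j => Part.some (t w j)).bind fun j => Part.ofOption (o w.2 j)
  have hT : Partrec T := by
    refine Partrec.bind (Partrec.rfind ht.to_comp.partrec₂) ?_
    exact Computable.ofOption (ho.to_comp.comp (Computable.snd.comp Computable.fst) Computable.snd)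
  obtain ⟨c, hc⟩ := hU.2 T hT
  refine ⟨c, fun y m X hX hcard hPX a ha => ?_⟩
  obtain ⟨j, hj, hnew, hlt⟩ : ∃ j, o y j = some (f y a) ∧ IsNewValue (o y) j ∧
      Nat.count (IsNewValue (o y)) j < X.ncard := by
    refine exists_isNewValue_count_lt hX ?_ ⟨Encodable.encode a, by simp [o, ha]⟩
    intro j x hx
    obtain ⟨b, -, hb⟩ := Option.bind_eq_some_iff.1 hx
    by_cases h : P y b
    · rw [if_pos h] at hb
      exact Option.some.inj hb ▸ hPX b h
    · simp [h] at hb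
  obtain ⟨p, hpm, hpv⟩ := exists_bitsValue_eq m _ (hlt.trans_le hcard)
  have hxT : f y a ∈ T (p, y) := by
    have hrf : j ∈ Nat.rfind fun j => Part.some (t (p, y) j) := by
      refine Nat.mem_rfind.2 ⟨?_, fun {i} hi => ?_⟩
      · simp [t, hnew, hpv]
      · simp only [t, Part.mem_some_iff, Bool.false_eq, decide_eq_false_iff_not, hpv]
        rintro ⟨h1, h2⟩
        -- A new value at stage `i < j` raises the count, so the two stages cannot have equal rank.
        have h3 := Nat.count_monotone (IsNewValue (o y)) (Nat.succ_le_of_lt hi)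
        rw [Nat.succ_eq_add_one, Nat.count_succ, if_pos h1] at h3
        omega
    exact Part.mem_bind hrf (by simp [hj])
  obtain ⟨q, hq, hqU⟩ := hc p y _ hxT
  have hle : kolmogorovComplexity U (f y a) y ≤ q.length := Nat.sInf_le ⟨q, rfl, hqU⟩
  exact hle.trans (hpm ▸ hq)

/-! ### Adjacency matrices as strings -/

/-- Adjacency in the graph on `0, …, n - 1` whose adjacency matrix has the entries of `a` above
the diagonal. -/
def MatrixAdj (a : List Bool) (n u v : ℕ) : Prop :=
  u ≠ v ∧ a.getD (n * min u v + max u v) false = true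

/-- The graph with the adjacency matrix `a`. -/
def matrixGraph (a : List Bool) (n : ℕ) : SimpleGraph (Fin n) where
  Adj u v := MatrixAdj a n u v
  symm := ⟨fun u v h => ⟨h.1.symm, by rw [min_comm, max_comm]; exact h.2⟩⟩
  loopless := ⟨fun _ h => h.1 rfl⟩

/-- The entries of the matrix `a` above the diagonal. -/
def matrixCode (n : ℕ) (a : List Bool) : List Bool :=
  (List.range n).flatMap fun u =>
    ((List.range n).filter fun v => u < v).map fun v => a.getD (n * u + v) false

theorem graphCode_matrixGraph (a : List Bool) (n : ℕ) :
    graphCode (matrixGraph a n) = matrixCode n a := by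
  unfold graphCode matrixCode
  rw [← List.map_coe_finRange_eq_range, List.flatMap_map]
  congr 1
  funext u
  rw [List.filter_map, List.map_map]
  refine List.map_congr_left fun v hv => ?_
  have huv : u < v := by simpa using hv
  have h1 : (u : ℕ) < v := huv
  have h2 : (matrixGraph a n).Adj u v ↔ a.getD (n * u + v) false = true := by
    change MatrixAdj a n u v ↔ _
    simp [MatrixAdj, h1.ne, min_eq_left h1.le, max_eq_right h1.le]
  simp [h2]

theorem exists_matrixGraph_eq {n : ℕ} (G : SimpleGraph (Fin n)) : ∃ a, matrixGraph a n = G := by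
  classical
  let a := List.ofFn fun i : Fin (n * n) =>
    decide (G.Adj (finProdFinEquiv.symm i).1 (finProdFinEquiv.symm i).2)
  have ha : ∀ u v : Fin n, a.getD (n * u + v) false = decide (G.Adj u v) := by
    intro u v
    have h : n * (u : ℕ) + v = (finProdFinEquiv (u, v) : ℕ) := by simp [add_comm]
    rw [h, List.getD_eq_getElem _ _ (by simp only [a, List.length_ofFn]; exact Fin.isLt _)]
    simp only [a, List.getElem_ofFn, Fin.eta, Equiv.symm_apply_apply]
  refine ⟨a, ?_⟩
  ext u v
  change MatrixAdj a n u v ↔ _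
  rcases lt_trichotomy u v with h | h | h
  · have h1 : (u : ℕ) < v := h
    simp [MatrixAdj, h1.ne, min_eq_left h1.le, max_eq_right h1.le, ha,
      -List.getD_eq_getElem?_getD]
  · simp [MatrixAdj, h]
  · have h1 : (v : ℕ) < u := h
    simp [MatrixAdj, h1.ne', min_eq_right h1.le, max_eq_left h1.le, ha, G.adj_comm,
      -List.getD_eq_getElem?_getD]

/-! ### Graphs described by routing data -/

/-- What is stored at a node: the code of the routing function, the label, and the degree. -/
abbrev NodeData : Type := List Bool × List Bool × ℕ

/-- What the node with data `d` uses to route to the node with data `e`, in a network of size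
`n`. -/
abbrev routerInput (n : ℕ) (d e : NodeData) : List Bool × List Bool × ℕ × ℕ × List Bool :=
  (d.1, d.2.1, d.2.2, n, e.2.1)

/-- `N` is a set of nodes other than `u` that contains exactly one node for each value that `φ`
takes on the nodes other than `u`. -/
def IsTransversal {V : Type*} (φ : V → ℕ) (u : V) (N : Set V) : Prop :=
  u ∉ N ∧ (∀ v, v ≠ u → ∃ w ∈ N, φ w = φ v) ∧ Set.InjOn φ N

open Classical in
/-- The port used at `u` for messages to `v`. -/
noncomputable def chosenPort (R : RouterLanguage) {n : ℕ} (D : Fin n → NodeData) (u v : Fin n) :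
    ℕ :=
  let r := R ⟨(D u).1, (D u).2.1, (D u).2.2, n, (D v).2.1⟩
  if h : r.Dom then r.get h else 0

theorem chosenPort_eq {R : RouterLanguage} {n : ℕ} {D : Fin n → NodeData} {u v : Fin n} {i : ℕ}
    (h : i ∈ R ⟨(D u).1, (D u).2.1, (D u).2.2, n, (D v).2.1⟩) : chosenPort R D u v = i := by
  obtain ⟨h1, h2⟩ := h
  simp only [chosenPort]
  rw [dif_pos h1]
  exact h2

/-- The neighbours of each node are a transversal of the ports chosen there. -/
def IsCompatible (R : RouterLanguage) {n : ℕ} (D : Fin n → NodeData) (G : SimpleGraph (Fin n)) :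
    Prop :=
  ∀ u, IsTransversal (chosenPort R D u) u (G.neighborSet u)

/-- The number of bits of a family of node data. -/
def dataBits {n : ℕ} (D : Fin n → NodeData) : ℕ :=
  ∑ u, ((D u).1.length + (D u).2.1.length)

/-- The codes of the graphs on `n` nodes compatible with few bits of node data. -/
def compactlyRoutedCodes (R : RouterLanguage) (n : ℕ) : Set (List Bool) :=
  {x | ∃ (G : SimpleGraph (Fin n)) (D : Fin n → NodeData), graphCode G = x ∧
    30 * dataBits D ≤ n * n ∧ (∀ u, (D u).2.2 ≤ n) ∧ IsCompatible R D G}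

/-- The result within `k` steps of the program `c` that routes from `u` to `v`. -/
def portWithin (c : Nat.Partrec.Code) (n : ℕ) (D : List NodeData) (k u v : ℕ) : Option ℕ :=
  c.evaln k (Encodable.encode (routerInput n (D.getD u default) (D.getD v default)))

/-- The condition on an adjacency matrix, node data, and a number of steps that within these steps
`c` routes as `IsCompatible` says; here for a pair of nodes. -/
def IsVerifiedAt (c : Nat.Partrec.Code) (n : ℕ) (w : List Bool × List NodeData × ℕ) (u v : ℕ) :
    Prop :=
  u = v ∨ (portWithin c n w.2.1 w.2.2 u v).isSome = true ∧
    (∃ z < n, MatrixAdj w.1 n u z ∧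
      portWithin c n w.2.1 w.2.2 u z = portWithin c n w.2.1 w.2.2 u v) ∧
    ∀ z < n, ¬ MatrixAdj w.1 n u v ∨ ¬ MatrixAdj w.1 n u z ∨
      portWithin c n w.2.1 w.2.2 u z ≠ portWithin c n w.2.1 w.2.2 u v ∨ z = v

/-- The decidable condition that certifies membership in `compactlyRoutedCodes`. -/
def IsVerified (c : Nat.Partrec.Code) (n : ℕ) (w : List Bool × List NodeData × ℕ) : Prop :=
  30 * ((List.range n).flatMap fun u =>
      (w.2.1.getD u default).1 ++ (w.2.1.getD u default).2.1).length ≤ n * n ∧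
    (∀ u < n, (w.2.1.getD u default).2.2 ≤ n) ∧ ∀ u < n, ∀ v < n, IsVerifiedAt c n w u v

/-! ### Primitive recursiveness of the verification -/

section Primrec

variable {γ : Type*} [Primcodable γ]

theorem primrecPred_matrixAdj {a : γ → List Bool} {n u v : γ → ℕ} (ha : Primrec a)
    (hn : Primrec n) (hu : Primrec u) (hv : Primrec v) :
    PrimrecPred fun z => MatrixAdj (a z) (n z) (u z) (v z) :=
  (Primrec.eq.comp hu hv).not.and
    (Primrec.eq.comp ((Primrec.list_getD false).comp ha
      (Primrec.nat_add.comp (Primrec.nat_mul.comp hn (Primrec.nat_min.comp hu hv))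
        (Primrec.nat_max.comp hu hv))) (Primrec.const true))

theorem primrec_portWithin (c : Nat.Partrec.Code) {n k u v : γ → ℕ} {D : γ → List NodeData}
    (hn : Primrec n) (hD : Primrec D) (hk : Primrec k) (hu : Primrec u) (hv : Primrec v) :
    Primrec fun z => portWithin c (n z) (D z) (k z) (u z) (v z) := by
  have h1 : Primrec fun z => (D z).getD (u z) default := (Primrec.list_getD default).comp hD hu
  have h2 : Primrec fun z => (D z).getD (v z) default := (Primrec.list_getD default).comp hD hv
  have h3 : Primrec fun z =>
      routerInput (n z) ((D z).getD (u z) default) ((D z).getD (v z) default) :=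
    (Primrec.fst.comp h1).pair ((Primrec.fst.comp (Primrec.snd.comp h1)).pair
      ((Primrec.snd.comp (Primrec.snd.comp h1)).pair
        (hn.pair (Primrec.fst.comp (Primrec.snd.comp h2)))))
  exact Nat.Partrec.Code.primrec_evaln.comp
    ((hk.pair (Primrec.const c)).pair (Primrec.encode.comp h3))

theorem primrecPred_isVerifiedAt (c : Nat.Partrec.Code) {n u v : γ → ℕ}
    {w : γ → List Bool × List NodeData × ℕ}
    (hn : Primrec n) (hw : Primrec w) (hu : Primrec u) (hv : Primrec v) :
    PrimrecPred fun z => IsVerifiedAt c (n z) (w z) (u z) (v z) := by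
  have s : Primrec (Prod.snd : ℕ × γ → γ) := Primrec.snd
  have f : Primrec (Prod.fst : ℕ × γ → ℕ) := Primrec.fst
  have hD := Primrec.fst.comp (Primrec.snd.comp hw)
  have hk := Primrec.snd.comp (Primrec.snd.comp hw)
  have ha := Primrec.fst.comp hw
  have huv := primrec_portWithin c hn hD hk hu hv
  have huz := primrec_portWithin c (hn.comp s) (hD.comp s) (hk.comp s) (hu.comp s) f
  have auz := primrecPred_matrixAdj (ha.comp s) (hn.comp s) (hu.comp s) f
  have auv := primrecPred_matrixAdj ha hn hu hv
  have hex : PrimrecRel fun (i : ℕ) (z : γ) => MatrixAdj (w z).1 (n z) (u z) i ∧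
      portWithin c (n z) (w z).2.1 (w z).2.2 (u z) i =
        portWithin c (n z) (w z).2.1 (w z).2.2 (u z) (v z) :=
    auz.and (Primrec.eq.comp huz (huv.comp s))
  have hall : PrimrecRel fun (i : ℕ) (z : γ) => ¬ MatrixAdj (w z).1 (n z) (u z) (v z) ∨
      ¬ MatrixAdj (w z).1 (n z) (u z) i ∨
      portWithin c (n z) (w z).2.1 (w z).2.2 (u z) i ≠
        portWithin c (n z) (w z).2.1 (w z).2.2 (u z) (v z) ∨ i = v z :=
    (auv.comp s).not.or (auz.not.or ((Primrec.eq.comp huz (huv.comp s)).not.or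
      (Primrec.eq.comp f (hv.comp s))))
  exact (Primrec.eq.comp hu hv).or ((Primrec.eq.comp (Primrec.option_isSome.comp huv)
    (Primrec.const true)).and (((primrecRel_exists_lt hex).comp hn Primrec.id).and
      ((primrecRel_forall_lt hall).comp hn Primrec.id)))

theorem primrecRel_isVerified (c : Nat.Partrec.Code) :
    PrimrecRel fun (y : ℕ) (w : List Bool × List NodeData × ℕ) =>
      IsVerified c y.unpair.1 w := by
  have hn : Primrec fun q : ℕ × List Bool × List NodeData × ℕ => q.1.unpair.1 :=
    Primrec.fst.comp (Primrec.unpair.comp Primrec.fst)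
  have hw : Primrec fun q : ℕ × List Bool × List NodeData × ℕ => q.2 := Primrec.snd
  have hD := Primrec.fst.comp (Primrec.snd.comp hw)
  have h1 : Primrec₂ fun (q : ℕ × List Bool × List NodeData × ℕ) (u : ℕ) =>
      q.2.2.1.getD u default :=
    (Primrec.list_getD default).comp (hD.comp Primrec.fst) Primrec.snd
  refine PrimrecPred.and ?_ (PrimrecPred.and ?_ ?_)
  · refine Primrec.nat_le.comp (Primrec.nat_mul.comp (Primrec.const 30) (Primrec.list_length.comp
      (Primrec.list_flatMap (Primrec.list_range.comp hn) ?_))) (Primrec.nat_mul.comp hn hn)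
    exact Primrec.list_append.comp (Primrec.fst.comp h1)
      (Primrec.fst.comp (Primrec.snd.comp h1))
  · have h2 : PrimrecRel fun (u : ℕ) (q : ℕ × List Bool × List NodeData × ℕ) =>
        (q.2.2.1.getD u default).2.2 ≤ q.1.unpair.1 :=
      Primrec.nat_le.comp (Primrec.snd.comp (Primrec.snd.comp
        (h1.comp Primrec.snd Primrec.fst))) (hn.comp Primrec.snd)
    exact (primrecRel_forall_lt h2).comp hn Primrec.id
  · have h3 : PrimrecRel fun (v : ℕ) (r : ℕ × ℕ × List Bool × List NodeData × ℕ) =>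
        IsVerifiedAt c r.2.1.unpair.1 r.2.2 r.1 v :=
      primrecPred_isVerifiedAt c (hn.comp (Primrec.snd.comp Primrec.snd))
        (hw.comp (Primrec.snd.comp Primrec.snd)) (Primrec.fst.comp Primrec.snd) Primrec.fst
    have h4 : PrimrecRel fun (u : ℕ) (q : ℕ × List Bool × List NodeData × ℕ) =>
        ∀ v < q.1.unpair.1, IsVerifiedAt c q.1.unpair.1 q.2 u v :=
      (primrecRel_forall_lt h3).comp (hn.comp Primrec.snd) Primrec.id
    exact (primrecRel_forall_lt h4).comp hn Primrec.id

theorem primrec_matrixCode :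
    Primrec₂ fun (y : ℕ) (w : List Bool × List NodeData × ℕ) => matrixCode y.unpair.1 w.1 := by
  have hn : Primrec fun q : ℕ × List Bool × List NodeData × ℕ => q.1.unpair.1 :=
    Primrec.fst.comp (Primrec.unpair.comp Primrec.fst)
  have hlt : PrimrecRel fun v u : ℕ => u < v := Primrec.nat_lt.comp Primrec.snd Primrec.fst
  refine Primrec.list_flatMap (Primrec.list_range.comp hn) ?_
  refine Primrec.list_map
    (hlt.listFilter.comp (Primrec.list_range.comp (hn.comp Primrec.fst)) Primrec.snd) ?_
  exact (Primrec.list_getD false).comp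
    (Primrec.fst.comp (Primrec.snd.comp (Primrec.fst.comp Primrec.fst)))
    (Primrec.nat_add.comp (Primrec.nat_mul.comp (hn.comp (Primrec.fst.comp Primrec.fst))
      (Primrec.snd.comp Primrec.fst)) Primrec.snd)

end Primrec

/-! ### Certificates versus routing schemes -/

theorem length_flatMap_range {n : ℕ} (D : List NodeData) :
    ((List.range n).flatMap fun u => (D.getD u default).1 ++ (D.getD u default).2.1).length =
      dataBits fun u : Fin n => D.getD u default := by
  rw [List.length_flatMap, ← List.map_coe_finRange_eq_range, List.map_map, dataBits,
    Fin.sum_univ_def]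
  simp [Function.comp_def]

/-- The code `c` computes the language `R`. -/
def Computes (c : Nat.Partrec.Code) (R : RouterLanguage) : Prop :=
  ∀ (t : List Bool × List Bool × ℕ × ℕ × List Bool) (i : ℕ),
    i ∈ R ⟨t.1, t.2.1, t.2.2.1, t.2.2.2.1, t.2.2.2.2⟩ ↔
      ∃ k, i ∈ c.evaln k (Encodable.encode t)

theorem RouterLanguage.Effective.exists_computes {R : RouterLanguage} (hR : R.Effective) :
    ∃ c, Computes c R := by
  obtain ⟨c, hc⟩ := Nat.Partrec.Code.exists_code.1 hR
  refine ⟨c, fun t i => ?_⟩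
  rw [← Nat.Partrec.Code.evaln_complete, hc]
  simp

/-- Soundness of certificates: every computation off the diagonal is required to halt, so the
default port `0` of `chosenPort` plays no role, and the two remaining clauses are existence and
uniqueness in the transversal condition. -/
theorem IsVerified.matrixCode_mem {c : Nat.Partrec.Code} {R : RouterLanguage} (hc : Computes c R)
    {n : ℕ} {w : List Bool × List NodeData × ℕ} (h : IsVerified c n w) :
    matrixCode n w.1 ∈ compactlyRoutedCodes R n := by
  obtain ⟨h1, h2, h3⟩ := h
  rw [length_flatMap_range] at h1
  refine ⟨matrixGraph w.1 n, fun u => w.2.1.getD u default, graphCode_matrixGraph _ _, h1,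
    fun u => h2 u u.2, fun u => ?_⟩
  have hport : ∀ v : Fin n, v ≠ u → portWithin c n w.2.1 w.2.2 u v =
      some (chosenPort R (fun u : Fin n => w.2.1.getD u default) u v) := by
    intro v hv
    obtain h4 | ⟨h4, -⟩ := h3 u u.2 v v.2
    · exact absurd (Fin.ext h4).symm hv
    · obtain ⟨i, hi⟩ := Option.isSome_iff_exists.1 h4
      rw [hi, chosenPort_eq ((hc (routerInput n (w.2.1.getD u default) (w.2.1.getD v default)) i).2
          ⟨_, hi⟩)]
  refine ⟨fun hu => hu.1 rfl, fun v hv => ?_, fun v hv z hz hvz => ?_⟩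
  · obtain h4 | ⟨-, ⟨z, hz, hadj, heq⟩, -⟩ := h3 u u.2 v v.2
    · exact absurd (Fin.ext h4).symm hv
    · refine ⟨⟨z, hz⟩, hadj, ?_⟩
      have hzu : (⟨z, hz⟩ : Fin n) ≠ u := fun h => hadj.1 (by rw [← h])
      have h5 := hport ⟨z, hz⟩ hzu
      rw [heq, hport v hv] at h5
      exact (Option.some.inj h5).symm
  · have hvu : v ≠ u := fun h => hv.1 (by rw [h])
    have hzu : z ≠ u := fun h => hz.1 (by rw [h])
    obtain h4 | ⟨-, -, h4⟩ := h3 u u.2 v v.2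
    · exact absurd (Fin.ext h4).symm hvu
    · rcases h4 z z.2 with h5 | h5 | h5 | h5
      · exact absurd hv h5
      · exact absurd hz h5
      · exact absurd (by rw [hport v hvu, hport z hzu, hvz]) h5
      · exact (Fin.ext h5).symm

/-- Every shortest path routing scheme gives compatible node data whose verification succeeds. -/
theorem exists_isVerified {c : Nat.Partrec.Code} {R : RouterLanguage} (hc : Computes c R)
    {n : ℕ} {G : SimpleGraph (Fin n)} {S : RoutingScheme G} (hS : S.IsShortestPath R)
    (hbits : 30 * ∑ u, ((S.stored u).length + (S.label u).length) ≤ n * n) :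
    ∃ w, IsVerified c n w ∧ matrixCode n w.1 = graphCode G := by
  obtain ⟨a, ha⟩ := exists_matrixGraph_eq G
  let D : List NodeData := List.ofFn fun u => (S.stored u, S.label u, nodeDegree G u)
  have hD : ∀ u : Fin n, D.getD u default = (S.stored u, S.label u, nodeDegree G u) := by
    intro u
    rw [List.getD_eq_getElem _ _ (by simp [D])]
    simp [D]
  have hadj : ∀ u v : Fin n, MatrixAdj a n u v ↔ G.Adj u v := by
    intro u v
    rw [← ha]
    rfl
  classical
  -- The number of the port of `u` leading to `w`. The value `0` is never the number of a port.
  let num : Fin n → Fin n → ℕ := fun u w =>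
    if h : G.Adj u w then ((S.port u).symm ⟨w, h⟩ : ℕ) else 0
  have hnum : ∀ u w z : Fin n, G.Adj u w → G.Adj u z → num u w = num u z → w = z := by
    intro u w z hw hz h
    simp only [num, dif_pos hw, dif_pos hz] at h
    exact congrArg Subtype.val ((S.port u).symm.injective (Subtype.ext h))
  have hstep : ∀ u v : Fin n, u ≠ v → ∃ w : Fin n, G.Adj u w ∧
      num u w ∈ R ⟨S.stored u, S.label u, nodeDegree G u, n, S.label v⟩ ∧
        (G.Adj u v → w = v) := by
    intro u v huv
    obtain ⟨q, hq, hlen⟩ := hS u v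
    cases q with
    | nil => exact absurd rfl huv
    | @cons _ w _ h q =>
      obtain ⟨⟨i, hi, hiw⟩, -⟩ := hq
      refine ⟨w, h, ?_, fun hadj => ?_⟩
      · have h1 : (S.port u).symm ⟨w, h⟩ = i := (S.port u).symm_apply_eq.2 (Subtype.ext hiw.symm)
        simpa only [num, dif_pos h, h1] using hi
      -- This is where shortest paths matter: at distance one the route ends after its first hop, so
      -- that hop is the destination.
      · rw [SimpleGraph.dist_eq_one_iff_adj.2 hadj, SimpleGraph.Walk.length_cons] at hlen
        exact SimpleGraph.Walk.eq_of_length_eq_zero (p := q) (by omega)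
  choose! nxt hnadj hmem hnxt using hstep
  have hfuel : ∀ u v : Fin n, ∃ k, u ≠ v → num u (nxt u v) ∈ portWithin c n D k u v := by
    intro u v
    by_cases huv : u = v
    · exact ⟨0, fun h => absurd huv h⟩
    · obtain ⟨k, hk⟩ := (hc (routerInput n (D.getD u default) (D.getD v default))
        (num u (nxt u v))).1 (by rw [hD, hD]; exact hmem u v huv)
      exact ⟨k, fun _ => hk⟩
  choose fuel hfuel using hfuel
  -- One step bound that suffices for all pairs at once.
  let k := Finset.univ.sup fun q : Fin n × Fin n => fuel q.1 q.2
  have hk : ∀ u v : Fin n, u ≠ v → portWithin c n D k u v = some (num u (nxt u v)) := fun u v huv =>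
    Nat.Partrec.Code.evaln_mono
      (Finset.le_sup (f := fun q : Fin n × Fin n => fuel q.1 q.2) (Finset.mem_univ (u, v)))
      (hfuel u v huv)
  refine ⟨(a, D, k), ⟨?_, ?_, ?_⟩, by rw [← graphCode_matrixGraph, ha]⟩
  · rw [length_flatMap_range]
    simpa only [dataBits, hD] using hbits
  · intro u hu
    have h := hD ⟨u, hu⟩
    simp only at h
    simp only [h]
    refine (Set.ncard_le_card _).trans ?_
    simp
  · intro u hu v hv
    by_cases huv : u = v
    · exact Or.inl huv
    have huv' : (⟨u, hu⟩ : Fin n) ≠ ⟨v, hv⟩ := fun h => huv (Fin.mk.inj h)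
    have key := hk ⟨u, hu⟩ ⟨v, hv⟩ huv'
    refine Or.inr ⟨Option.isSome_iff_exists.2 ⟨_, key⟩, ?_, ?_⟩
    · have hadj1 := hnadj _ _ huv'
      -- The neighbour sharing the port of `v` is the first hop towards `v`: messages addressed to
      -- that hop use the same edge.
      refine ⟨nxt ⟨u, hu⟩ ⟨v, hv⟩, Fin.isLt _, (hadj ⟨u, hu⟩ _).2 hadj1, ?_⟩
      refine (hk ⟨u, hu⟩ _ hadj1.ne).trans (Eq.trans ?_ key.symm)
      rw [hnxt _ _ hadj1.ne hadj1]
    · intro z hz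
      by_contra! hcon
      obtain ⟨h1, h2, h3, h4⟩ := hcon
      have h1' := (hadj ⟨u, hu⟩ ⟨v, hv⟩).1 h1
      have h2' := (hadj ⟨u, hu⟩ ⟨z, hz⟩).1 h2
      have h5 := Option.some.inj (((hk ⟨u, hu⟩ ⟨z, hz⟩ h2'.ne).symm.trans h3).trans key)
      rw [hnxt _ _ huv' h1', hnxt _ _ h2'.ne h2'] at h5
      exact h4 (Fin.mk.inj (hnum _ _ _ h2' h1' h5))

/-! ### Counting -/

/-- A rational substitute for the sharp bound `x ≤ 3 ^ (x / 3)`: the exponent becomes `3/5` bit per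
point, slightly lossy but sufficient. -/
theorem pow_five_le_eight_pow (x : ℕ) : x ^ 5 ≤ 8 ^ x := by
  rcases Nat.lt_or_ge x 3 with h | h
  · interval_cases x <;> norm_num
  · induction x, h using Nat.le_induction with
    | base => norm_num
    | succ x hx ih =>
      rw [pow_succ 8]
      -- From `x ≥ 3` on, one step multiplies the left side by at most `(4/3) ^ 5 < 8`.
      have h1 : (3 * (x + 1)) ^ 5 ≤ (4 * x) ^ 5 := Nat.pow_le_pow_left (by omega) 5
      rw [mul_pow, mul_pow] at h1
      omega

open Classical in
/-- The elements of `V` other than `u` at which `φ` has the value `i`. -/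
noncomputable def puncturedFiber {V : Type*} [Fintype V] (φ : V → ℕ) (u : V) (i : ℕ) : Finset V :=
  {v ∈ Finset.univ.erase u | φ v = i}

/-- A transversal picks one point from each punctured fibre, so the number of choices is at most the
product of the fibre sizes, while these sizes add up to `|V| - 1`. -/
theorem card_isTransversal_pow_le {V : Type*} [Fintype V] (φ : V → ℕ) (u : V) :
    Nat.card {N : Set V // IsTransversal φ u N} ^ 5 ≤ 8 ^ Fintype.card V := by
  classical
  let I := (Finset.univ.erase u).image φ
  let F : (∀ i ∈ I, V) → Set V := fun g => {w | ∃ i hi, g i hi = w}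
  have hsub : {N : Set V | IsTransversal φ u N} ⊆
      F '' ((I.pi (puncturedFiber φ u) : Finset (∀ i ∈ I, V)) : Set (∀ i ∈ I, V)) := by
    rintro N ⟨huN, hex, hinj⟩
    have h : ∀ i ∈ I, ∃ w ∈ N, φ w = i := by
      intro i hi
      obtain ⟨v, hv, rfl⟩ := Finset.mem_image.1 hi
      exact hex v (Finset.ne_of_mem_erase hv)
    choose g hgN hg using h
    refine ⟨g, ?_, ?_⟩
    · rw [Finset.mem_coe, Finset.mem_pi]
      intro i hi
      simp only [puncturedFiber, Finset.mem_filter, Finset.mem_erase, Finset.mem_univ, and_true]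
      exact ⟨fun h => huN (h ▸ hgN i hi), hg i hi⟩
    · ext w
      constructor
      · rintro ⟨i, hi, rfl⟩
        exact hgN i hi
      · intro hw
        have hi : φ w ∈ I :=
          Finset.mem_image_of_mem _ (Finset.mem_erase.2 ⟨fun h => huN (h ▸ hw), Finset.mem_univ _⟩)
        exact ⟨φ w, hi, hinj (hgN _ hi) hw (hg _ hi)⟩
  have h1 : Nat.card {N : Set V // IsTransversal φ u N} ≤ ∏ i ∈ I, (puncturedFiber φ u i).card := by
    have h2 : {N : Set V | IsTransversal φ u N}.ncard ≤ _ :=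
      (Set.ncard_le_ncard hsub ((Finset.finite_toSet _).image _)).trans
        (Set.ncard_image_le (Finset.finite_toSet _))
    rw [Set.ncard_coe_finset, Finset.card_pi] at h2
    exact h2
  have h3 : ∑ i ∈ I, (puncturedFiber φ u i).card = (Finset.univ.erase u).card :=
    (Finset.card_eq_sum_card_image φ _).symm
  calc Nat.card {N : Set V // IsTransversal φ u N} ^ 5
      ≤ (∏ i ∈ I, (puncturedFiber φ u i).card) ^ 5 := Nat.pow_le_pow_left h1 5
    _ = ∏ i ∈ I, (puncturedFiber φ u i).card ^ 5 := (Finset.prod_pow _ _ _).symm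
    _ ≤ ∏ i ∈ I, 8 ^ (puncturedFiber φ u i).card :=
      Finset.prod_le_prod' fun i _ => pow_five_le_eight_pow _
    _ = 8 ^ (Finset.univ.erase u).card := by rw [Finset.prod_pow_eq_pow_sum, h3]
    _ ≤ 8 ^ Fintype.card V := Nat.pow_le_pow_right (by norm_num) (Finset.card_le_univ _)

theorem card_simpleGraph_le (V : Type*) [Fintype V] :
    Nat.card (SimpleGraph V) ≤ 2 ^ (Fintype.card V).choose 2 := by
  classical
  have hinj : Function.Injective fun (G : SimpleGraph V) =>
      ({e | (e : Sym2 V) ∈ G.edgeSet} : Set {e : Sym2 V // ¬ e.IsDiag}) := by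
    intro G H h
    refine SimpleGraph.edgeSet_injective (Set.ext fun e => ?_)
    by_cases he : e.IsDiag
    · exact iff_of_false (fun h => G.not_isDiag_of_mem_edgeSet h he)
        (fun h => H.not_isDiag_of_mem_edgeSet h he)
    · exact Set.ext_iff.1 h ⟨e, he⟩
  refine (Nat.card_le_card_of_injective _ hinj).trans ?_
  rw [Nat.card_eq_fintype_card, Fintype.card_set, Sym2.card_subtype_not_diag]

/-- A compatible graph is determined by the neighbourhoods of its first `K` nodes, each a
transversal, together with the induced graph on the other nodes. Leaving `K` free allows a balance
between the two costs. -/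
theorem card_isCompatible_le (R : RouterLanguage) {n K : ℕ} (hK : K ≤ n) (D : Fin n → NodeData) :
    Nat.card {G : SimpleGraph (Fin n) // IsCompatible R D G} ≤
      2 ^ (3 * (n * K) / 5 + 1) * 2 ^ (n - K).choose 2 := by
  classical
  let A : Fin K → Type := fun u =>
    {N : Set (Fin n) // IsTransversal (chosenPort R D (u.castLE hK)) (u.castLE hK) N}
  let V : Type := {u : Fin n // ¬ (u : ℕ) < K}
  let F : {G : SimpleGraph (Fin n) // IsCompatible R D G} → (∀ u, A u) × SimpleGraph V :=
    fun G => (fun u => ⟨G.1.neighborSet (u.castLE hK), G.2 _⟩, G.1.comap Subtype.val)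
  have hF : Function.Injective F := by
    rintro ⟨G, hG⟩ ⟨H, hH⟩ h
    have h1 : ∀ u v : Fin n, (u : ℕ) < K → (G.Adj u v ↔ H.Adj u v) := by
      intro u v hu
      have h2 := congrArg Subtype.val (congrFun (congrArg Prod.fst h) ⟨u, hu⟩)
      exact Set.ext_iff.1 h2 v
    refine Subtype.ext (SimpleGraph.ext (funext fun u => funext fun v => propext ?_))
    by_cases hu : (u : ℕ) < K
    · exact h1 u v hu
    by_cases hv : (v : ℕ) < K
    · rw [G.adj_comm, H.adj_comm]
      exact h1 v u hv
    · have h2 := congrArg (fun G' : SimpleGraph V => G'.Adj ⟨u, hu⟩ ⟨v, hv⟩) (congrArg Prod.snd h)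
      exact iff_of_eq h2
  refine (Nat.card_le_card_of_injective F hF).trans ?_
  rw [Nat.card_prod, Nat.card_pi]
  refine Nat.mul_le_mul ?_ ?_
  · refine (Nat.pow_le_pow_iff_left (n := 5) (by norm_num)).1 ?_
    rw [← Finset.prod_pow]
    calc ∏ u, Nat.card (A u) ^ 5 ≤ ∏ _u : Fin K, 8 ^ n :=
          Finset.prod_le_prod' fun u _ => by
            simpa using card_isTransversal_pow_le (chosenPort R D (u.castLE hK)) (u.castLE hK)
      _ = 2 ^ (3 * (n * K)) := by
          rw [Finset.prod_const, Finset.card_univ, Fintype.card_fin, ← pow_mul, pow_mul 2 3]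
          norm_num
      _ ≤ (2 ^ (3 * (n * K) / 5 + 1)) ^ 5 := by
          rw [← pow_mul]
          exact Nat.pow_le_pow_right (by norm_num) (by omega)
  · have hV : Fintype.card V = n - K := by
      have h1 : Fintype.card V = Fintype.card (Fin n) - Fintype.card {u : Fin n // (u : ℕ) < K} :=
        Fintype.card_subtype_compl _
      have h2 : Fintype.card {u : Fin n // (u : ℕ) < K} = K := by
        rw [Fintype.card_congr (Fin.castLEquiv hK).symm, Fintype.card_fin]
      rw [h1, h2, Fintype.card_fin]
    exact hV ▸ card_simpleGraph_le V

/-! ### Counting node data by weights -/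

/-- The binary strings of length at most `s`. -/
def stringsUpTo : ℕ → Finset (List Bool)
  | 0 => {[]}
  | s + 1 => insert [] ((Finset.univ ×ˢ stringsUpTo s).image fun p => p.1 :: p.2)

theorem mem_stringsUpTo {s : ℕ} {x : List Bool} (h : x.length ≤ s) : x ∈ stringsUpTo s := by
  induction s generalizing x with
  | zero => simpa [stringsUpTo] using h
  | succ s ih =>
    cases x with
    | nil => simp [stringsUpTo]
    | cons b x =>
      have := ih (x := x) (by simpa using h)
      simp [stringsUpTo, this]

/-- Splitting off the first bit gives the recursion `1 + 2 · (1/4) · S`, which preserves `S ≤ 2`. -/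
theorem sum_stringsUpTo_le (s : ℕ) :
    ∑ x ∈ stringsUpTo s, (1 / 4 : ℚ) ^ x.length ≤ 2 := by
  induction s with
  | zero => norm_num [stringsUpTo]
  | succ s ih =>
    rw [stringsUpTo, Finset.sum_insert (by simp), Finset.sum_image (by
      rintro ⟨a, x⟩ - ⟨b, y⟩ - h
      simpa using h), Finset.sum_product]
    simp only [List.length_cons, pow_succ, ← Finset.sum_mul, List.length_nil, pow_zero,
      Finset.sum_const, Finset.card_univ, Fintype.card_bool]
    norm_num
    linarith

/-- Families of node data with at most `s` bits and degrees at most `n`. -/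
def dataFamilies (n s : ℕ) : Finset (Fin n → NodeData) :=
  {D ∈ Fintype.piFinset fun _ : Fin n =>
    stringsUpTo s ×ˢ stringsUpTo s ×ˢ Finset.range (n + 1) | dataBits D ≤ s}

theorem mem_dataFamilies {n s : ℕ} {D : Fin n → NodeData} (h : dataBits D ≤ s)
    (hd : ∀ u, (D u).2.2 ≤ n) : D ∈ dataFamilies n s := by
  have h1 : ∀ u, (D u).1.length + (D u).2.1.length ≤ s := fun u =>
    (Finset.single_le_sum (f := fun u => (D u).1.length + (D u).2.1.length)
      (fun _ _ => Nat.zero_le _) (Finset.mem_univ u)).trans h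
  simp only [dataFamilies, Finset.mem_filter, Fintype.mem_piFinset, Finset.mem_product,
    Finset.mem_range]
  refine ⟨fun u => ⟨mem_stringsUpTo ?_, mem_stringsUpTo ?_, Nat.lt_succ_of_le (hd u)⟩, h⟩ <;>
    have := h1 u <;> omega

/-- Give each bit weight `1/4`. A family with at most `s` bits then weighs at least `4 ^ (-s)`, and
the total weight factors over the nodes, each factor being at most `2 · 2 · (n + 1)`. No separators
between the strings have to be encoded. -/
theorem card_dataFamilies_le (n s : ℕ) :
    (dataFamilies n s).card ≤ 4 ^ s * (4 * (n + 1)) ^ n := by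
  let t := stringsUpTo s ×ˢ stringsUpTo s ×ˢ Finset.range (n + 1)
  let f : NodeData → ℚ := fun d => (1 / 4) ^ (d.1.length + d.2.1.length)
  have hf : ∀ d, 0 ≤ f d := fun d => by positivity
  have h1 : ∑ d ∈ t, f d ≤ 4 * (n + 1) := by
    have h2 := sum_stringsUpTo_le s
    have h3 : ∑ d ∈ t, f d = (∑ x ∈ stringsUpTo s, (1 / 4 : ℚ) ^ x.length) *
        ((∑ x ∈ stringsUpTo s, (1 / 4 : ℚ) ^ x.length) * (n + 1)) := by
      simp only [t, f, Finset.sum_product, pow_add, Finset.sum_const, Finset.card_range,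
        Finset.sum_mul, Finset.mul_sum, nsmul_eq_mul, Nat.cast_add, Nat.cast_one]
      rw [Finset.sum_comm]
      refine Finset.sum_congr rfl fun x _ => Finset.sum_congr rfl fun y _ => by ring
    have h0 : 0 ≤ ∑ x ∈ stringsUpTo s, (1 / 4 : ℚ) ^ x.length :=
      Finset.sum_nonneg fun _ _ => by positivity
    rw [h3]
    have hn : (0 : ℚ) ≤ n + 1 := by positivity
    nlinarith [mul_le_mul_of_nonneg_right (mul_le_mul h2 h2 h0 (by norm_num)) hn]
  have h4 : ((dataFamilies n s).card : ℚ) * (1 / 4) ^ s ≤ (4 * (n + 1)) ^ n := by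
    calc ((dataFamilies n s).card : ℚ) * (1 / 4) ^ s
        = ∑ _D ∈ dataFamilies n s, (1 / 4 : ℚ) ^ s := by simp
      _ ≤ ∑ D ∈ dataFamilies n s, ∏ u, f (D u) := Finset.sum_le_sum fun D hD => by
          rw [Finset.prod_pow_eq_pow_sum]
          exact pow_le_pow_of_le_one (by norm_num) (by norm_num) (Finset.mem_filter.1 hD).2
      _ ≤ ∑ D ∈ Fintype.piFinset fun _ : Fin n => t, ∏ u, f (D u) :=
          Finset.sum_le_sum_of_subset_of_nonneg (Finset.filter_subset _ _)
            fun D _ _ => Finset.prod_nonneg fun u _ => hf _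
      _ = ∏ _u : Fin n, ∑ d ∈ t, f d := (Finset.prod_univ_sum _ _).symm
      _ = (∑ d ∈ t, f d) ^ n := by simp
      _ ≤ (4 * (n + 1)) ^ n := pow_le_pow_left₀ (Finset.sum_nonneg fun _ _ => hf _) h1 n
  have h5 : ((dataFamilies n s).card : ℚ) ≤ 4 ^ s * (4 * (n + 1)) ^ n := by
    rw [one_div, inv_pow, ← div_eq_mul_inv, div_le_iff₀ (by positivity)] at h4
    linarith
  exact_mod_cast h5

theorem compactlyRoutedCodes_subset (R : RouterLanguage) (n : ℕ) :
    compactlyRoutedCodes R n ⊆ ⋃ D ∈ dataFamilies n (n * n / 30),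
      graphCode '' {G : SimpleGraph (Fin n) | IsCompatible R D G} := by
  rintro x ⟨G, D, rfl, hs, hd, hG⟩
  simp only [Set.mem_iUnion]
  exact ⟨D, mem_dataFamilies (by omega) hd, G, hG, rfl⟩

theorem finite_compactlyRoutedCodes (R : RouterLanguage) (n : ℕ) :
    (compactlyRoutedCodes R n).Finite :=
  ((dataFamilies n (n * n / 30)).finite_toSet.biUnion fun _ _ =>
    (Set.toFinite _).image _).subset (compactlyRoutedCodes_subset R n)

/-- The exponent of two that bounds the number of graphs with few bits of routing data. -/
def countExponent (n : ℕ) : ℕ :=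
  2 * (n * n / 30) + (2 + n.size) * n + (3 * (n * (n / 2)) / 5 + 1) + (n - n / 2).choose 2

theorem ncard_compactlyRoutedCodes_le (R : RouterLanguage) (n : ℕ) :
    (compactlyRoutedCodes R n).ncard ≤ 2 ^ countExponent n := by
  have h1 : (compactlyRoutedCodes R n).ncard ≤ (dataFamilies n (n * n / 30)).card *
      (2 ^ (3 * (n * (n / 2)) / 5 + 1) * 2 ^ (n - n / 2).choose 2) := by
    refine (Set.ncard_le_ncard (compactlyRoutedCodes_subset R n)
      ((Finset.finite_toSet _).biUnion fun _ _ => (Set.toFinite _).image _)).trans ?_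
    refine (Finset.set_ncard_biUnion_le _ _).trans ?_
    refine Finset.sum_le_card_nsmul _ _ _ fun D _ => ?_
    exact (Set.ncard_image_le (Set.toFinite _)).trans
      (card_isCompatible_le R (Nat.div_le_self n 2) D)
  have h2 : 4 * (n + 1) ≤ 2 ^ (2 + n.size) := by
    have := Nat.lt_size_self n
    rw [pow_add]
    omega
  have h3 : (dataFamilies n (n * n / 30)).card ≤
      2 ^ (2 * (n * n / 30) + (2 + n.size) * n) := by
    refine (card_dataFamilies_le _ _).trans ?_
    rw [pow_add, pow_mul, pow_mul]
    exact Nat.mul_le_mul (by norm_num) (Nat.pow_le_pow_left h2 n)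
  refine h1.trans ((Nat.mul_le_mul_right _ h3).trans (le_of_eq ?_))
  rw [countExponent, pow_add _ _ ((n - n / 2).choose 2), pow_add _ _ (3 * (n * (n / 2)) / 5 + 1),
    mul_assoc]

/-! ### The lower bound -/

/-- Binary lengths are `o(n)`, since `n < 2 ^ (n / N)` for large `n`. -/
theorem eventually_size_mul_le (N : ℕ) (hN : 0 < N) : ∀ᶠ n : ℕ in atTop, N * n.size ≤ n := by
  have h1 : ∀ᶠ q : ℕ in atTop, (N : ℝ) * ((q : ℝ) + 1) < 2 ^ q := by
    have h2 := (tendsto_pow_const_div_const_pow_of_one_lt 1 (r := (2 : ℝ)) one_lt_two)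
    have h3 := (tendsto_pow_const_div_const_pow_of_one_lt 0 (r := (2 : ℝ)) one_lt_two)
    have h4 := (h2.add h3).const_mul (N : ℝ)
    simp only [add_zero, mul_zero] at h4
    filter_upwards [h4.eventually_lt_const one_pos] with q hq
    rw [← add_div, mul_div_assoc', div_lt_one (by positivity)] at hq
    simpa using hq
  obtain ⟨q₀, hq₀⟩ := eventually_atTop.1 h1
  filter_upwards [eventually_ge_atTop (N * q₀)] with n hn
  have h2 : n < 2 ^ (n / N) := by
    have h3 := hq₀ (n / N) ((Nat.le_div_iff_mul_le hN).2 (by rwa [mul_comm]))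
    have h4 : N * (n / N + 1) < 2 ^ (n / N) := by exact_mod_cast h3
    have h5 := Nat.lt_mul_div_succ n hN
    omega
  calc N * n.size ≤ N * (n / N) := Nat.mul_le_mul_left _ (Nat.size_le.2 h2)
    _ ≤ n := Nat.mul_div_le n N

theorem eventually_countExponent_lt {δ : ℕ → ℕ}
    (hδ : (fun n : ℕ => (δ n : ℝ)) =o[atTop] (fun n : ℕ => (n : ℝ))) (c : ℕ) :
    ∀ᶠ n : ℕ in atTop,
      (countExponent n : ℝ) + c < (n : ℝ) * ((n : ℝ) - 1) / 2 - (δ n : ℝ) := by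
  -- The quadratic terms add up to `59/120 + 1/480 = 237/480`, where `1/480` pays for `n * n.size`.
  -- This leaves `1/160` below `1/2`, enough for the linear terms, `δ n ≤ n` and `c`.
  filter_upwards [eventually_size_mul_le 480 (by norm_num), hδ.def one_pos,
    eventually_ge_atTop (160 * (5 + c))] with n hsize hδn hn
  rw [Real.norm_natCast, Real.norm_natCast, one_mul] at hδn
  have hs : (480 : ℝ) * n.size ≤ n := by exact_mod_cast hsize
  have hn' : (160 : ℝ) * (5 + c) ≤ n := by exact_mod_cast hn
  have hc : (0 : ℝ) ≤ c := Nat.cast_nonneg c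
  have h1 : ((n * n / 30 : ℕ) : ℝ) ≤ n * n / 30 := by
    have := Nat.cast_div_le (α := ℝ) (m := n * n) (n := 30)
    simpa using this
  have h2 : ((3 * (n * (n / 2)) / 5 : ℕ) : ℝ) ≤ 3 * (n * n) / 10 := by
    have h3 : ((3 * (n * (n / 2)) / 5 : ℕ) : ℝ) ≤ 3 * (n * (n / 2 : ℕ)) / 5 := by
      have := Nat.cast_div_le (α := ℝ) (m := 3 * (n * (n / 2))) (n := 5)
      simpa using this
    have h4 : ((n / 2 : ℕ) : ℝ) ≤ n / 2 := by
      have := Nat.cast_div_le (α := ℝ) (m := n) (n := 2)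
      simpa using this
    have h5 := mul_le_mul_of_nonneg_left h4 (Nat.cast_nonneg (α := ℝ) n)
    linarith
  have h3 : (((n - n / 2).choose 2 : ℕ) : ℝ) ≤ n * n / 8 := by
    have h4 : ((n - n / 2 : ℕ) : ℝ) ≤ (n + 1) / 2 := by
      have : 2 * (n - n / 2) ≤ n + 1 := by omega
      have : (2 : ℝ) * (n - n / 2 : ℕ) ≤ n + 1 := by exact_mod_cast this
      linarith
    have h5 : (1 : ℝ) ≤ (n - n / 2 : ℕ) := by
      have : 1 ≤ n - n / 2 := by omega
      exact_mod_cast this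
    rw [Nat.cast_choose_two]
    nlinarith
  have h4 : (480 : ℝ) * n.size * n ≤ n * n :=
    mul_le_mul_of_nonneg_right hs (Nat.cast_nonneg n)
  have h5 : (160 : ℝ) * (5 + c) * n ≤ n * n :=
    mul_le_mul_of_nonneg_right hn' (Nat.cast_nonneg n)
  have h6 : (c : ℝ) ≤ c * n := by
    have : (1 : ℝ) ≤ n := by linarith
    nlinarith
  simp only [countExponent]
  push_cast at h1 h2 h3 ⊢
  nlinarith

/-- Treats the label models uniformly: labels that are not charged are numbers up to `n`, hence
short. -/
theorem LabelModel.Allows.length_label_le {n : ℕ} {l : Fin n → List Bool} {lm : LabelModel}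
    (h : lm.Allows l) (u : Fin n) : (l u).length ≤ lm.labelCost (l u) + n.size := by
  have hbits : ∀ v : Fin n, (initialLabel v).length ≤ n.size := fun v => by
    rw [initialLabel, Nat.size_eq_bits_len]
    exact Nat.size_le_size v.2
  cases lm with
  | α =>
    have h' : l = initialLabel := h
    exact (h' ▸ hbits u).trans (Nat.le_add_left _ _)
  | β =>
    obtain ⟨σ, rfl⟩ := h
    exact (hbits _).trans (Nat.le_add_left _ _)
  | γ => exact Nat.le_add_right _ _

theorem sum_length_le_totalBits {n : ℕ} {G : SimpleGraph (Fin n)} {S : RoutingScheme G}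
    {lm : LabelModel} (h : lm.Allows S.label) :
    ∑ u, ((S.stored u).length + (S.label u).length) ≤ S.totalBits lm + n * n.size := by
  calc ∑ u, ((S.stored u).length + (S.label u).length)
      ≤ ∑ u, (((S.stored u).length + lm.labelCost (S.label u)) + n.size) :=
        Finset.sum_le_sum fun u _ => by
          have := h.length_label_le u
          omega
    _ = S.totalBits lm + n * n.size := by
        rw [Finset.sum_add_distrib, RoutingScheme.totalBits]
        simp

theorem eventually_le_totalBits
    (U : List Bool × ℕ →. List Bool) (hU : IsUniversal U)
    (R : RouterLanguage) (hR : R.Effective)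
    (δ : ℕ → ℕ) (hδ : (fun n : ℕ => (δ n : ℝ)) =o[atTop] (fun n : ℕ => (n : ℝ))) :
    ∀ᶠ n : ℕ in atTop, ∀ G : SimpleGraph (Fin n), IsRandomGraph U δ G →
      ∀ (lm : LabelModel) (S : RoutingScheme G), lm.Allows S.label → S.IsShortestPath R →
        (n : ℝ) ^ 2 / 32 ≤ (S.totalBits lm : ℝ) := by
  obtain ⟨cd, hcd⟩ := hR.exists_computes
  obtain ⟨c, hc⟩ := exists_kolmogorovComplexity_le hU (primrecRel_isVerified cd) primrec_matrixCode
  filter_upwards [eventually_size_mul_le 480 (by norm_num), eventually_countExponent_lt hδ c]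
    with n hsize hlt G hG lm S hl hS
  by_contra! hcon
  -- The threshold `1/30` is `1/32 + 1/480`: the assumed total plus the uncharged labels.
  have hbits : 30 * ∑ u, ((S.stored u).length + (S.label u).length) ≤ n * n := by
    have h1 : 32 * S.totalBits lm < n ^ 2 := by
      have : (32 : ℝ) * S.totalBits lm < n ^ 2 := by linarith
      exact_mod_cast this
    have h2 := sum_length_le_totalBits hl
    have h3 := Nat.mul_le_mul_left n hsize
    nlinarith
  obtain ⟨w, hw, hcode⟩ := exists_isVerified hcd hS hbits
  have hle := hc (Nat.pair n (δ n)) (countExponent n) (compactlyRoutedCodes R n)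
    (finite_compactlyRoutedCodes R n) (ncard_compactlyRoutedCodes_le R n)
    (fun w hw => by
      rw [Nat.unpair_pair] at hw ⊢
      exact hw.matrixCode_mem hcd) w (by rwa [Nat.unpair_pair])
  rw [Nat.unpair_pair, hcode] at hle
  have hle' : (kolmogorovComplexity U (graphCode G) (Nat.pair n (δ n)) : ℝ) ≤
      countExponent n + c := by exact_mod_cast hle
  have hrandom : (n : ℝ) * ((n : ℝ) - 1) / 2 - (δ n : ℝ) ≤ _ := hG
  linarith

theorem mainTheorem7
    (U : List Bool × ℕ →. List Bool) (hU : IsUniversal U)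
    (R : RouterLanguage) (hR : R.Effective)
    (δ : ℕ → ℕ) (hδ : (fun n : ℕ => (δ n : ℝ)) =o[atTop] (fun n : ℕ => (n : ℝ))) :
    ∃ g : ℕ → ℝ, g =o[atTop] (fun n : ℕ => (n : ℝ) ^ 2) ∧
      ∀ (n : ℕ) (G : SimpleGraph (Fin n)), IsRandomGraph U δ G →
        ∀ (pm : PortModel) (lm : LabelModel) (P₀ : PortAssignment G) (S : RoutingScheme G),
          pm.Allows P₀ S.port → lm.Allows S.label → S.IsShortestPath R →
            (n : ℝ) ^ 2 / 32 - g n ≤ (S.totalBits lm : ℝ) := by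
  obtain ⟨N, hN⟩ := eventually_atTop.1 (eventually_le_totalBits U hU R hR δ hδ)
  -- The bound holds without error term for large `n`, so `g` only makes the finitely many small
  -- cases trivial.
  refine ⟨fun n => if n < N then (n : ℝ) ^ 2 else 0, ?_, ?_⟩
  · refine (isLittleO_zero _ _).congr' ?_ EventuallyEq.rfl
    filter_upwards [eventually_ge_atTop N] with n hn
    rw [if_neg (not_lt.2 hn)]
  · intro n G hG pm lm P₀ S _ hl hS
    by_cases hn : n < N
    · have h1 : (0 : ℝ) ≤ S.totalBits lm := Nat.cast_nonneg _
      have h2 : (0 : ℝ) ≤ (n : ℝ) ^ 2 := by positivity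
      simp only [if_pos hn]
      linarith
    · simp only [if_neg hn, sub_zero]
      exact hN n (not_lt.1 hn) G hG lm S hl hS
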